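/- Let $X$ be a complex Banach space and $1\le p\le\infty$. Put $\mathcal S_p=c_0$ if $p=\infty$ and $\mathcal S_p=\ell_2$ if $1\le p<\infty$ (complex sequences indexed by $\mathbb N=\{1,2,\dots\}$), and let $B_{c_0}\cap\mathcal S_p=\{z\in\mathcal S_p:\sup_n|z_n|<1\}$, an open subset of the Banach space $\mathcal S_p$. Let $\mathbb D$ be the open unit disc, and let $\mathbb T^m$ be the $m$-dimensional torus with its normalized Haar measure $d\omega$. For $m\in\mathbb N$, let $H_p(\mathbb D^m,X)$ be the space of all holomorphic functions $f:\mathbb D^m\to X$ with $\|f\|_{H_p(\mathbb D^m,X)}<\infty$, where $$\|f\|_{H_p(\mathbb D^m,X)}=\sup_{0<r<1}\Big(\int_{\mathbb T^m}\|f(r\omega)\|_X^p\,d\omega\Big)^{1/p}\ (p<\infty),\qquad \|f\|_{H_\infty(\mathbb D^m,X)}=\sup_{z\in\mathbb D^m}\|f(z)\|_X .$$ Let $H_p(B_{c_0}\cap\mathcal S_p,X)$ be the space of all holomorphic functions $F:B_{c_0}\cap\mathcal S_p\to X$ with $\|F\|_{H_p(B_{c_0}\cap\mathcal S_p,X)}<\infty$,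 where, with $F_m(z_1,\dots,z_m)=F(z_1,\dots,z_m,0,0,\dots)$, $$\|F\|_{H_p(B_{c_0}\cap\mathcal S_p,X)}=\sup_{m\in\mathbb N}\sup_{0<r<1}\Big(\int_{\mathbb T^m}\|F_m(r\omega)\|_X^p\,d\omega\Big)^{1/p}\ (p<\infty),\qquad \|F\|_{H_\infty(B_{c_0},X)}=\sup_{z\in B_{c_0}}\|F(z)\|_X .$$ The monomial coefficients $c_\alpha(f)$, $\alpha\in\mathbb N_0^m$, of $f\in H_p(\mathbb D^m,X)$ are those with $f(z)=\sum_{\alpha\in\mathbb N_0^m}c_\alpha(f)z^\alpha$ for all $z\in\mathbb D^m$. The monomial coefficients $c_\alpha(F)$ of $F\in H_p(B_{c_0}\cap\mathcal S_p,X)$, where $\alpha$ runs over the set $\mathbb N_0^{(\mathbb N)}$ of eventually null sequences in $\mathbb N_0$, are those with $F_m(z)=\sum_{\alpha\in\mathbb N_0^m}c_\alpha(F)z^\alpha$ for all $m\in\mathbb N$ and $z\in\mathbb D^m$; here $\mathbb N_0^m\subset\mathbb N_0^{(\mathbb N)}$ by appending zeros. Let $(c_\alpha)_{\alpha\in\mathbb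 N_0^{(\mathbb N)}}$ be a family in $X$. The following assertions are equivalent: (i) There is $F\in H_p(B_{c_0}\cap\mathcal S_p,X)$ with $c_\alpha(F)=c_\alpha$ for each $\alpha\in\mathbb N_0^{(\mathbb N)}$. (ii) There is a sequence $(f_m)_{m\in\mathbb N}$ with $f_m\in H_p(\mathbb D^m,X)$ such that (ii.1) $c_\alpha(f_m)=c_\alpha$ for each $m\in\mathbb N$ and $\alpha\in\mathbb N_0^m$, and (ii.2) $\sup_{m\in\mathbb N}\|f_m\|_{H_p(\mathbb D^m,X)}<\infty$. Moreover, in that case, for every $F$ as in (i) and every $(f_m)$ as in (ii), $\|F\|_{H_p(B_{c_0}\cap\mathcal S_p,X)}=\sup_{m\in\mathbb N}\|f_m\|_{H_p(\mathbb D^m,X)}$. -/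

import Mathlib

open Filter Topology MeasureTheory
open scoped ENNReal ZeroAtInfty

namespace HardyHilbert

noncomputable section

/-- A Banach space `S` of complex sequences contained in `c₀` for which the canonical vectors
`e n` form a `1`-unconditional basis. The inclusion `S ⊂ c₀` is the injective linear map `toC0`;
here `C₀(ℕ, ℂ)` is the Banach space `c₀` of null sequences with the supremum norm. -/
class BanachSequenceSpace (S : Type*) [NormedAddCommGroup S] [NormedSpace ℂ S]
    [CompleteSpace S] where
  /-- the inclusion of `S` in `c₀` -/
  toC0 : S →ₗ[ℂ] C₀(ℕ, ℂ)
  toC0_injective : Function.Injective toC0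
  /-- the canonical vectors -/
  e : ℕ → S
  toC0_e : ∀ n k : ℕ, toC0 (e n) k = if k = n then 1 else 0
  tendsto_sum : ∀ x : S,
    Tendsto (fun N : ℕ => ∑ n ∈ Finset.range N, toC0 x n • e n) atTop (𝓝 x)
  norm_le_norm : ∀ x y : S, (∀ n, ‖toC0 x n‖ ≤ ‖toC0 y n‖) → ‖x‖ ≤ ‖y‖

open BanachSequenceSpace

/-! ### The sequence spaces `c₀` and `ℓ₂` -/

/-- A null sequence as an element of `c₀`. -/
def mkC0 (x : ℕ → ℂ) (hx : Tendsto x atTop (𝓝 0)) : C₀(ℕ, ℂ) where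
  toFun := x
  continuous_toFun := continuous_of_discreteTopology
  zero_at_infty' := by
    rw [Filter.cocompact_eq_cofinite, Nat.cofinite_eq_atTop]
    exact hx

lemma c0_tendsto (x : C₀(ℕ, ℂ)) : Tendsto (fun n => x n) atTop (𝓝 0) := by
  have h := zero_at_infty x
  rwa [Filter.cocompact_eq_cofinite, Nat.cofinite_eq_atTop] at h

lemma c0_norm_le_iff (x : C₀(ℕ, ℂ)) {C : ℝ} (hC : 0 ≤ C) : ‖x‖ ≤ C ↔ ∀ n, ‖x n‖ ≤ C := by
  rw [← ZeroAtInftyContinuousMap.norm_toBCF_eq_norm, BoundedContinuousFunction.norm_le hC]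
  rfl

/-- The canonical vectors of `c₀`. -/
def c0Basis (n : ℕ) : C₀(ℕ, ℂ) :=
  mkC0 (fun k => if k = n then 1 else 0) (by
    refine tendsto_const_nhds.congr' ?_
    filter_upwards [eventually_gt_atTop n] with k hk
    simp [hk.ne'])

lemma c0Basis_apply (n k : ℕ) : c0Basis n k = if k = n then 1 else 0 := rfl

lemma c0_sum_apply (a : ℕ → ℂ) (N k : ℕ) :
    (∑ n ∈ Finset.range N, a n • c0Basis n) k = if k < N then a k else 0 := by
  induction N with
  | zero => simp
  | succ N ih =>
    rw [Finset.sum_range_succ, ZeroAtInftyContinuousMap.add_apply, ih,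
      ZeroAtInftyContinuousMap.smul_apply, c0Basis_apply]
    rcases lt_trichotomy k N with h | h | h
    · simp [h, h.ne, h.trans (Nat.lt_succ_self N)]
    · simp [h]
    · have h1 : ¬ k < N := by omega
      have h2 : ¬ k < N + 1 := by omega
      simp [h1, h2, h.ne']

instance instC0 : BanachSequenceSpace C₀(ℕ, ℂ) where
  toC0 := LinearMap.id
  toC0_injective := fun _ _ h => h
  e := c0Basis
  toC0_e := c0Basis_apply
  tendsto_sum := by
    intro x
    rw [Metric.tendsto_atTop]
    intro ε hε
    obtain ⟨N, hN⟩ := Metric.tendsto_atTop.1 (c0_tendsto x) (ε / 2) (by positivity)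
    refine ⟨N, fun M hM => ?_⟩
    rw [dist_eq_norm]
    refine lt_of_le_of_lt ((c0_norm_le_iff _ (by positivity)).2 fun k => ?_) (half_lt_self hε)
    rw [ZeroAtInftyContinuousMap.sub_apply]
    simp only [LinearMap.id_apply]
    rw [c0_sum_apply]
    by_cases hk : k < M
    · simp [hk]; positivity
    · have := hN k (by omega)
      rw [dist_zero_right] at this
      simpa [hk] using this.le
  norm_le_norm := by
    intro x y h
    refine (c0_norm_le_iff x (norm_nonneg y)).2 fun n => (h n).trans ?_
    exact (c0_norm_le_iff y (norm_nonneg y)).1 le_rfl n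

/-- The Hilbert space of square summable complex sequences. -/
abbrev L2Seq : Type := lp (fun _ : ℕ => ℂ) 2

lemma l2_tendsto (x : L2Seq) : Tendsto (fun n => x n) atTop (𝓝 0) := by
  have h := ((lp.memℓp x).summable (by norm_num)).tendsto_atTop_zero
  rw [tendsto_zero_iff_norm_tendsto_zero]
  have h2 : Tendsto (fun n => Real.sqrt (‖x n‖ ^ 2)) atTop (𝓝 0) := by
    have := (Real.continuous_sqrt.tendsto 0).comp h
    simpa [Function.comp_def] using this
  simpa [Real.sqrt_sq] using h2

instance instL2 : BanachSequenceSpace L2Seq where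
  toC0 :=
    { toFun := fun x => mkC0 (fun n => x n) (l2_tendsto x)
      map_add' := fun _ _ => rfl
      map_smul' := fun _ _ => rfl }
  toC0_injective := by
    intro x y h
    refine lp.ext (funext fun n => ?_)
    exact DFunLike.congr_fun h n
  e := fun n => lp.single 2 n (1 : ℂ)
  toC0_e := by
    intro n k
    change (lp.single 2 n (1 : ℂ) : L2Seq) k = _
    rw [lp.single_apply, Pi.single_apply]
  tendsto_sum := by
    intro x
    have h := (lp.hasSum_single (by norm_num) x).tendsto_sum_nat
    refine h.congr fun N => Finset.sum_congr rfl fun n _ => ?_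
    have h1 : lp.single (E := fun _ : ℕ => ℂ) 2 n (x n • (1 : ℂ))
        = x n • lp.single (E := fun _ : ℕ => ℂ) 2 n (1 : ℂ) := lp.single_smul 2 n (x n) 1
    rw [smul_eq_mul, mul_one] at h1
    exact h1
  norm_le_norm := by
    intro x y h
    exact lp.norm_mono (by norm_num) h

/-! ### Hardy spaces on polydiscs -/

/-- The open unit polydisc `𝔻^m`. -/
def polydisc (m : ℕ) : Set (Fin m → ℂ) := {z | ∀ i, ‖z i‖ < 1}

/-- The normalized Haar measure on the `m`-dimensional torus; the torus is parametrized by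
`(ℝ/ℤ)^m` through `t ↦ (exp (2πi t₁), …, exp (2πi t_m))`. -/
def torusMeasure (m : ℕ) : Measure (Fin m → UnitAddCircle) :=
  Measure.pi fun _ => AddCircle.haarAddCircle

/-- The point `(r ω₁, …, r ω_m)` with `ω_j = exp (2πi t_j)`. -/
def torusPoint {m : ℕ} (r : ℝ) (t : Fin m → UnitAddCircle) : Fin m → ℂ :=
  fun i => (r : ℂ) * ((t i).toCircle : ℂ)

variable {X : Type*} [NormedAddCommGroup X] [NormedSpace ℂ X]

/-- `sup_{0 < r < 1} (∫ ‖f (r ω)‖^p dω)^{1/p}`, for finite `p`. -/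
def integralNorm (p : ℝ≥0∞) (m : ℕ) (f : (Fin m → ℂ) → X) : ℝ≥0∞ :=
  ⨆ r ∈ Set.Ioo (0 : ℝ) 1,
    (∫⁻ t, ‖f (torusPoint r t)‖ₑ ^ p.toReal ∂(torusMeasure m)) ^ (1 / p.toReal)

/-- The norm of `H_p(𝔻^m, X)`, with value `∞` outside of the space. -/
def polydiscNorm (p : ℝ≥0∞) (m : ℕ) (f : (Fin m → ℂ) → X) : ℝ≥0∞ :=
  if p = ∞ then ⨆ z ∈ polydisc m, ‖f z‖ₑ else integralNorm p m f

/-- `f ∈ H_p(𝔻^m, X)`. -/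
def MemHardyPolydisc (p : ℝ≥0∞) (m : ℕ) (f : (Fin m → ℂ) → X) : Prop :=
  DifferentiableOn ℂ f (polydisc m) ∧ polydiscNorm p m f < ∞

/-- `c` restricted to `ℕ₀^m` is the family of monomial coefficients of `f` on `𝔻^m`:
`f z = ∑_{α ∈ ℕ₀^m} c_α z^α` for all `z ∈ 𝔻^m`. A multi-index in `ℕ₀^m` is viewed as a finitely
supported sequence by appending zeros. -/
def HasCoeffsPolydisc (m : ℕ) (f : (Fin m → ℂ) → X) (c : (ℕ →₀ ℕ) → X) : Prop :=
  ∀ z ∈ polydisc m,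
    HasSum (fun α : Fin m →₀ ℕ => (∏ i, z i ^ α i) • c (α.embDomain Fin.valEmbedding)) (f z)

/-! ### Hardy spaces on `B_{c₀} ∩ S` -/

section SequenceSpace

variable (S : Type*) [NormedAddCommGroup S] [NormedSpace ℂ S] [CompleteSpace S]
  [BanachSequenceSpace S]

/-- `B_{c₀} ∩ S`, where `B_{c₀}` is the open unit ball of `c₀`, as a subset of `S`. -/
def unitDomain : Set S := {z | ‖toC0 z‖ < 1}

/-- `(z₁, …, z_m) ↦ (z₁, …, z_m, 0, 0, …)`. -/
def finIncl (m : ℕ) (z : Fin m → ℂ) : S := ∑ i, z i • e (i : ℕ)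

variable {S}

/-- The norm of `H_p(B_{c₀} ∩ S, X)`, with value `∞` outside of the space. -/
def hardyNorm (p : ℝ≥0∞) (F : S → X) : ℝ≥0∞ :=
  if p = ∞ then ⨆ z ∈ unitDomain S, ‖F z‖ₑ
  else ⨆ m : ℕ+, integralNorm p m fun z => F (finIncl S m z)

/-- `F ∈ H_p(B_{c₀} ∩ S, X)`. Holomorphy is complex Fréchet differentiability on the open set
`B_{c₀} ∩ S` of the Banach space `S`. -/
def MemHardy (p : ℝ≥0∞) (F : S → X) : Prop :=
  DifferentiableOn ℂ F (unitDomain S) ∧ hardyNorm p F < ∞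

/-- `c` is the family of monomial coefficients of `F`: for every `m`, the restriction of `F` to
the first `m` variables is `∑_{α ∈ ℕ₀^m} c_α z^α` on `𝔻^m`. -/
def HasCoeffs (F : S → X) (c : (ℕ →₀ ℕ) → X) : Prop :=
  ∀ m : ℕ+, HasCoeffsPolydisc m (fun z => F (finIncl S m z)) c

end SequenceSpace

end

end HardyHilbert

open HardyHilbert

/-! From (i) to (ii), the finite sections of F serve as the `f m`. Pointwise uniqueness of the sum
of the monomial series makes any other admissible `f m` agree with them, and this gives the equality
of norms; for p = ∞ it also needs continuity of F and convergence of finite sections x_m → x in S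
(`hardyNorm_eq_iSup`).

Conversely, equal coefficients make the `f m` coherent: setting the extra variables to zero in a
later one recovers an earlier one (`HasCoeffsPolydisc.eq_comp_castLE`). Composed with coordinate
projections they become holomorphic functions on B_{c₀} ∩ S that are eventually constant at finitely
supported points. If they are locally uniformly bounded, the Schwarz lemma makes them locally
equi-Lipschitz, so they converge everywhere by density, and a Taylor estimate uniform in n makes the
limit holomorphic (`exists_differentiableOn_hasCoeffs`).

The local bound is immediate for p = ∞. For p < ∞ it comes from ∏(1 - |a_i|²) ‖f(a)‖ ≤ ‖f‖_{H_p}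
(`prod_mul_enorm_le_integralNorm`): the product stays away from 0, independently of the number of
variables, when ∑|a_i|² is bounded and sup|a_i| stays below 1. This is why ℓ₂ is the domain. -/

namespace HardyHilbert


/-! ### Bounded holomorphic maps on balls of a normed space -/

open Metric in
theorem norm_sub_le_of_differentiableOn_ball {E X : Type*} [NormedAddCommGroup E]
    [NormedSpace ℂ E] [NormedAddCommGroup X] [NormedSpace ℂ X] {f : E → X} {a z : E} {R C : ℝ}
    (hd : DifferentiableOn ℂ f (ball a R)) (hC : ∀ z ∈ ball a R, ‖f z‖ ≤ C) (hz : z ∈ ball a R) :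
    ‖f z - f a‖ ≤ 2 * C / R * ‖z - a‖ := by
  have ha : a ∈ ball a R := mem_ball_self (nonempty_ball.1 ⟨z, hz⟩)
  rw [← dist_eq_norm, ← dist_eq_norm]
  -- Schwarz lemma: the values stay within 2C of `f a`.
  refine Complex.dist_le_div_mul_dist_of_mapsTo_ball hd (fun w hw => ?_) hz
  rw [mem_closedBall, dist_eq_norm]
  linarith [norm_sub_le (f w) (f a), hC w hw, hC a ha]

open Metric in
theorem norm_fderiv_le_of_differentiableOn_ball {E X : Type*} [NormedAddCommGroup E]
    [NormedSpace ℂ E] [NormedAddCommGroup X] [NormedSpace ℂ X] {f : E → X} {a : E} {R C : ℝ}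
    (hR : 0 < R) (hd : DifferentiableOn ℂ f (ball a R)) (hC : ∀ z ∈ ball a R, ‖f z‖ ≤ C) :
    ‖fderiv ℂ f a‖ ≤ 2 * C / R := by
  refine Complex.norm_fderiv_le_div_of_mapsTo_ball hd (fun w hw => ?_) hR
  rw [mem_closedBall, dist_eq_norm]
  linarith [norm_sub_le (f w) (f a), hC w hw, hC a (mem_ball_self hR)]

open Metric in
/-- Second order Taylor estimate for bounded holomorphic maps. -/
theorem norm_sub_sub_fderiv_le {E X : Type*} [NormedAddCommGroup E]
    [NormedSpace ℂ E] [NormedAddCommGroup X] [NormedSpace ℂ X] {f : E → X} {a z : E} {R C : ℝ}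
    (hd : DifferentiableOn ℂ f (ball a R)) (hC : ∀ z ∈ ball a R, ‖f z‖ ≤ C) (hz : z ∈ ball a R) :
    ‖f z - f a - fderiv ℂ f a (z - a)‖ ≤ 4 * C * (‖z - a‖ / R) ^ 2 := by
  have hR : 0 < R := nonempty_ball.1 ⟨z, hz⟩
  have ha : a ∈ ball a R := mem_ball_self hR
  have hL := norm_fderiv_le_of_differentiableOn_ball hR hd hC
  have hda : HasFDerivAt f (fderiv ℂ f a) a :=
    (hd.differentiableAt (ball_mem_nhds a hR)).hasFDerivAt
  -- Without its linear part the map is constant to first order at `a`, so the higher order Schwarz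
  -- lemma applies. The radius 4C adds 2C for the oscillation of `f` and 2C for the derivative term.
  have key := Complex.dist_le_mul_div_pow_of_mapsTo_ball_of_isLittleO
    (f := fun w => f w - fderiv ℂ f a (w - a)) (c := a) (R₁ := R) (R₂ := 4 * C) (n := 1) (z := z)
    ?_ ?_ ?_ hz
  · simp only [dist_eq_norm, sub_self, map_zero, sub_zero] at key
    refine le_trans (le_of_eq ?_) key
    congr 1
    abel
  · fun_prop
  · intro w hw
    simp only [mem_closedBall, dist_eq_norm, sub_self, map_zero, sub_zero]
    have h1 : ‖fderiv ℂ f a (w - a)‖ ≤ 2 * C := by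
      have hw' : ‖w - a‖ ≤ R := by rw [← dist_eq_norm]; exact (mem_ball.1 hw).le
      calc ‖fderiv ℂ f a (w - a)‖ ≤ 2 * C / R * R :=
            (ContinuousLinearMap.le_opNorm _ _).trans
              (mul_le_mul hL hw' (norm_nonneg _) ((norm_nonneg _).trans hL))
        _ = 2 * C := by field_simp
    calc ‖f w - fderiv ℂ f a (w - a) - f a‖
        ≤ ‖f w‖ + ‖fderiv ℂ f a (w - a)‖ + ‖f a‖ :=
          (norm_sub_le _ _).trans (by gcongr; exact norm_sub_le _ _)
      _ ≤ 4 * C := by linarith [hC w hw, hC a ha]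
  · have := hda.isLittleO
    simp only [pow_one, sub_self, map_zero, sub_zero]
    refine (this.congr_left fun w => ?_).norm_right
    abel

open Metric in
/-- A pointwise limit of uniformly bounded holomorphic maps on a ball of a Banach space is
differentiable at the center. -/
theorem differentiableAt_of_tendsto_of_bounded {E X : Type*} [NormedAddCommGroup E]
    [NormedSpace ℂ E] [CompleteSpace E] [NormedAddCommGroup X] [NormedSpace ℂ X] [CompleteSpace X]
    {f : ℕ → E → X} {g : E → X} {a : E} {R C : ℝ} (hR : 0 < R)
    (hd : ∀ n, DifferentiableOn ℂ (f n) (ball a R)) (hC : ∀ n, ∀ z ∈ ball a R, ‖f n z‖ ≤ C)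
    (hg : ∀ z ∈ ball a R, Tendsto (fun n => f n z) atTop (𝓝 (g z))) :
    DifferentiableAt ℂ g a := by
  have ha : a ∈ ball a R := mem_ball_self hR
  have hC0 : 0 ≤ C := (norm_nonneg _).trans (hC 0 a ha)
  -- For a fixed step t the difference quotients converge in n, and they approximate the derivatives
  -- with an error O(t) uniform in n.
  have hcau : ∀ h : E, CauchySeq fun n => fderiv ℂ (f n) a h := by
    intro h
    rw [Metric.cauchySeq_iff']
    intro ε hε
    set K : ℝ := 4 * C * (‖h‖ / R) ^ 2 with hK
    have hK0 : 0 ≤ K := by positivity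
    -- The first bound keeps `a + t • h` in the ball; the second makes the Taylor error t²K at most
    -- tε/4, so that three such errors stay below tε.
    set t : ℝ := min (R / (2 * (‖h‖ + 1))) (ε / (4 * (K + 1))) with ht
    have ht0 : 0 < t := by positivity
    have hmem : a + (t : ℂ) • h ∈ ball a R := by
      rw [mem_ball, dist_eq_norm, add_sub_cancel_left, norm_smul, Complex.norm_real,
        Real.norm_of_nonneg ht0.le]
      calc t * ‖h‖ ≤ R / (2 * (‖h‖ + 1)) * (‖h‖ + 1) :=
            mul_le_mul (min_le_left _ _) (by linarith) (norm_nonneg _) (by positivity)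
        _ = R / 2 := by field_simp
        _ < R := by linarith
    have htK : t * K ≤ ε / 4 := by
      calc t * K ≤ ε / (4 * (K + 1)) * (K + 1) :=
            mul_le_mul (min_le_right _ _) (by linarith) hK0 (by positivity)
        _ = ε / 4 := by field_simp
    have hq : ∀ n, ‖f n (a + (t : ℂ) • h) - f n a - (t : ℂ) • fderiv ℂ (f n) a h‖ ≤ t * (ε / 4) := by
      intro n
      have := norm_sub_sub_fderiv_le (hd n) (hC n) hmem
      rw [add_sub_cancel_left, map_smul, norm_smul, Complex.norm_real,
        Real.norm_of_nonneg ht0.le] at this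
      refine this.trans ?_
      calc 4 * C * (t * ‖h‖ / R) ^ 2 = t * (t * K) := by rw [hK]; ring
        _ ≤ _ := by gcongr
    have hdiff : CauchySeq fun n => f n (a + (t : ℂ) • h) - f n a :=
      ((hg _ hmem).sub (hg _ ha)).cauchySeq
    obtain ⟨N, hN⟩ := Metric.cauchySeq_iff'.1 hdiff (t * (ε / 4)) (by positivity)
    refine ⟨N, fun n hn => ?_⟩
    have h1 := hN n hn
    rw [dist_eq_norm] at h1 ⊢
    have h2 : t * ‖fderiv ℂ (f n) a h - fderiv ℂ (f N) a h‖ < t * ε := by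
      have h3 : t * ‖fderiv ℂ (f n) a h - fderiv ℂ (f N) a h‖
          = ‖(t : ℂ) • (fderiv ℂ (f n) a h - fderiv ℂ (f N) a h)‖ := by
        rw [norm_smul, Complex.norm_real, Real.norm_of_nonneg ht0.le]
      rw [h3]
      have h4 : (t : ℂ) • (fderiv ℂ (f n) a h - fderiv ℂ (f N) a h)
          = (f n (a + (t : ℂ) • h) - f n a - (f N (a + (t : ℂ) • h) - f N a))
            - (f n (a + (t : ℂ) • h) - f n a - (t : ℂ) • fderiv ℂ (f n) a h)
            + (f N (a + (t : ℂ) • h) - f N a - (t : ℂ) • fderiv ℂ (f N) a h) := by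
        rw [smul_sub]; abel
      rw [h4]
      refine lt_of_le_of_lt ((norm_add_le _ _).trans (add_le_add_left (norm_sub_le _ _) _)) ?_
      nlinarith [hq n, hq N, mul_pos ht0 hε]
    exact lt_of_mul_lt_mul_left h2 ht0.le
  choose L hL using fun h => cauchySeq_tendsto_of_complete (hcau h)
  -- Banach–Steinhaus makes the pointwise limit of the derivatives continuous; completeness of `E`
  -- is used here.
  let T : E →L[ℂ] X := continuousLinearMapOfTendsto (fun n => fderiv ℂ (f n) a)
    (tendsto_pi_nhds.2 hL)
  have hest : ∀ z ∈ ball a R, ‖g z - g a - T (z - a)‖ ≤ 4 * C * (‖z - a‖ / R) ^ 2 := by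
    intro z hz
    have hlim : Tendsto (fun n => ‖f n z - f n a - fderiv ℂ (f n) a (z - a)‖) atTop
        (𝓝 ‖g z - g a - T (z - a)‖) :=
      (((hg z hz).sub (hg a ha)).sub (hL (z - a))).norm
    exact le_of_tendsto hlim (Eventually.of_forall fun n => norm_sub_sub_fderiv_le (hd n) (hC n) hz)
  refine HasFDerivAt.differentiableAt (f' := T) (HasFDerivAt.of_isLittleO ?_)
  have hO : (fun z => g z - g a - T (z - a)) =O[𝓝 a] fun z => ‖z - a‖ ^ 2 := by
    refine Asymptotics.IsBigO.of_bound (4 * C / R ^ 2) ?_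
    filter_upwards [ball_mem_nhds a hR] with z hz
    refine (hest z hz).trans (le_of_eq ?_)
    rw [Real.norm_of_nonneg (by positivity)]
    field_simp
  refine hO.trans_isLittleO ?_
  have h1 : (fun z : E => ‖z - a‖ ^ 2) =o[𝓝 a] fun z => ‖z - a‖ ^ 1 :=
    (Asymptotics.isLittleO_pow_pow (m := 1) (n := 2) (𝕜 := ℝ) (by norm_num)).comp_tendsto
      (by
        have : Tendsto (fun z : E => ‖z - a‖) (𝓝 a) (𝓝 ‖a - a‖) :=
          (Continuous.tendsto (by fun_prop) a)
        simpa using this)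
  simpa using h1


/-! ### Point evaluation in vector valued Hardy spaces -/

theorem circleAverage_eq_integral_haarAddCircle {X : Type*} [NormedAddCommGroup X]
    [NormedSpace ℝ X] (f : ℂ → X) :
    Real.circleAverage f 0 1
      = ∫ t : UnitAddCircle, f (t.toCircle : ℂ) ∂AddCircle.haarAddCircle := by
  rw [AddCircle.integral_haarAddCircle, inv_one, one_smul,
    ← UnitAddCircle.intervalIntegral_preimage 0, Real.circleAverage]
  have h := intervalIntegral.smul_integral_comp_mul_left (a := 0) (b := 1)
    (fun θ => f (circleMap 0 1 θ)) (2 * Real.pi)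
  rw [mul_zero, mul_one] at h
  rw [← h, smul_smul, inv_mul_cancel₀ (by positivity), one_smul, zero_add]
  refine intervalIntegral.integral_congr fun x _ => ?_
  simp only [AddCircle.toCircle_apply_mk, Circle.coe_exp, circleMap]
  simp

/-- The sharp point evaluation estimate in the vector valued Hardy space `H₁` of the disc. -/
theorem enorm_mul_le_lintegral_circle {X : Type*} [NormedAddCommGroup X] [NormedSpace ℂ X]
    [CompleteSpace X] {f : ℂ → X} (hf : DiffContOnCl ℂ f (Metric.ball 0 1)) {a : ℂ} (ha : ‖a‖ < 1) :
    ENNReal.ofReal (1 - ‖a‖ ^ 2) * ‖f a‖ₑ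
      ≤ ∫⁻ t : UnitAddCircle, ‖f (t.toCircle : ℂ)‖ₑ ∂AddCircle.haarAddCircle := by
  -- Cauchy's formula is applied to (1 - āz) f(z): at a the extra factor equals 1 - |a|², and on the
  -- circle it cancels the modulus of the Cauchy kernel.
  have hg : DiffContOnCl ℂ (fun z => (1 - starRingEnd ℂ a * z) • f z) (Metric.ball 0 |1|) := by
    rw [abs_one]
    refine DiffContOnCl.smul (Differentiable.diffContOnCl ?_) hf
    fun_prop
  have h := hg.circleAverage_smul_div (w := a) (by simpa using ha)
  rw [circleAverage_eq_integral_haarAddCircle] at h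
  have h2 : ENNReal.ofReal (1 - ‖a‖ ^ 2) * ‖f a‖ₑ = ‖(1 - starRingEnd ℂ a * a) • f a‖ₑ := by
    rw [enorm_smul, Complex.conj_mul', ← ofReal_norm (1 - _)]
    congr 2
    have : 0 ≤ 1 - ‖a‖ ^ 2 := by nlinarith [norm_nonneg a]
    rw [← Complex.ofReal_pow, ← Complex.ofReal_one, ← Complex.ofReal_sub, Complex.norm_real,
      Real.norm_of_nonneg this]
  rw [h2, ← h]
  refine (enorm_integral_le_lintegral_enorm _).trans (lintegral_mono fun t => le_of_eq ?_)
  set w : ℂ := (t.toCircle : ℂ) with hw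
  have hw1 : ‖w‖ = 1 := Circle.norm_coe _
  have hwa : w - a ≠ 0 := by
    intro h0
    rw [sub_eq_zero] at h0
    rw [← h0, hw1] at ha
    exact lt_irrefl _ ha
  have hn : ‖1 - starRingEnd ℂ a * w‖ = ‖w - a‖ := by
    have h3 : w * starRingEnd ℂ (w - a) = 1 - starRingEnd ℂ a * w := by
      rw [map_sub, mul_sub, Complex.mul_conj', hw1]
      push_cast
      ring
    rw [← h3, norm_mul, hw1, one_mul, Complex.norm_conj]
  have hk : ‖(w - 0) / (w - a) * (1 - starRingEnd ℂ a * w)‖ = 1 := by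
    rw [norm_mul, norm_div, hn, sub_zero, hw1]
    field_simp [norm_ne_zero_iff.2 hwa]
  rw [smul_smul, enorm_smul, ← ofReal_norm (_ * _), hk, ENNReal.ofReal_one, one_mul]

theorem continuous_torusPoint {m : ℕ} (r : ℝ) : Continuous (torusPoint (m := m) r) := by
  refine continuous_pi fun i => continuous_const.mul ?_
  exact continuous_subtype_val.comp (AddCircle.continuous_toCircle.comp (continuous_apply i))

theorem norm_torusPoint {m : ℕ} {r : ℝ} (hr : 0 ≤ r) (t : Fin m → UnitAddCircle) (i : Fin m) :
    ‖torusPoint r t i‖ = r := by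
  rw [torusPoint, norm_mul, Circle.norm_coe, Complex.norm_real, Real.norm_of_nonneg hr, mul_one]

instance (m : ℕ) : IsProbabilityMeasure (torusMeasure m) := by
  unfold torusMeasure; infer_instance

/-- The point evaluation estimate in `H₁` of the polydisc, for maps holomorphic on a
neighbourhood of the closed polydisc. -/
theorem prod_mul_enorm_le_lintegral_torus {X : Type*} [NormedAddCommGroup X] [NormedSpace ℂ X]
    [CompleteSpace X] (m : ℕ) {f : (Fin m → ℂ) → X}
    (hf : ∀ z, (∀ i, ‖z i‖ ≤ 1) → DifferentiableAt ℂ f z) {a : Fin m → ℂ} (ha : a ∈ polydisc m) :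
    ENNReal.ofReal (∏ i, (1 - ‖a i‖ ^ 2)) * ‖f a‖ₑ
      ≤ ∫⁻ t, ‖f (torusPoint 1 t)‖ₑ ∂(torusMeasure m) := by
  induction m with
  | zero =>
    have : ∀ t : Fin 0 → UnitAddCircle, torusPoint 1 t = a := fun t => Subsingleton.elim _ _
    simp [this]
  | succ m ih =>
    -- The induction hypothesis treats the last m variables with the first frozen at w; the disc
    -- estimate `h2` treats the first, and Tonelli (`h3`) joins them.
    have h1 : ∀ w : ℂ, ‖w‖ ≤ 1 → ENNReal.ofReal (∏ i : Fin m, (1 - ‖a i.succ‖ ^ 2))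
        * ‖f (Fin.cons w (Fin.tail a))‖ₑ
        ≤ ∫⁻ t, ‖f (Fin.cons w (torusPoint 1 t))‖ₑ ∂(torusMeasure m) := by
      intro w hw
      refine ih (f := fun z => f (Fin.cons w z)) (a := Fin.tail a) (fun z hz => ?_)
        (fun i => ha i.succ)
      refine DifferentiableAt.comp z (g := f) (hf _ ?_) ?_
      · exact Fin.cases (by simpa using hw) (fun i => by simpa using hz i)
      · rw [differentiableAt_pi]
        exact Fin.cases (by simp) (fun i => by simp; fun_prop)
    have h2 : ENNReal.ofReal (1 - ‖a 0‖ ^ 2) * ‖f a‖ₑ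
        ≤ ∫⁻ t : UnitAddCircle, ‖f (Fin.cons (t.toCircle : ℂ) (Fin.tail a))‖ₑ
          ∂AddCircle.haarAddCircle := by
      have := enorm_mul_le_lintegral_circle (f := fun w => f (Fin.cons w (Fin.tail a)))
        (a := a 0) (DifferentiableOn.diffContOnCl ?_) (ha 0)
      · simpa using this
      · rw [closure_ball _ one_ne_zero]
        intro w hw
        refine DifferentiableAt.differentiableWithinAt ?_
        refine DifferentiableAt.comp w (g := f) (hf _ ?_) ?_
        · exact Fin.cases (by simpa using hw) (fun i => by simpa using! (ha i.succ).le)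
        · rw [differentiableAt_pi]
          exact Fin.cases (by simp) (fun i => by simp)
    have hpos : 0 ≤ ∏ i : Fin m, (1 - ‖a i.succ‖ ^ 2) :=
      Finset.prod_nonneg fun i _ => by nlinarith [norm_nonneg (a i.succ), ha i.succ]
    have hcont : Continuous fun t : Fin (m + 1) → UnitAddCircle => f (torusPoint 1 t) := by
      refine continuous_iff_continuousAt.2 fun t => ?_
      refine ContinuousAt.comp (g := f) (hf _ fun i => ?_).continuousAt
        (continuous_torusPoint 1).continuousAt
      rw [norm_torusPoint zero_le_one]
    have hmp := (measurePreserving_piFinSuccAbove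
      (fun _ : Fin (m + 1) => (AddCircle.haarAddCircle : Measure UnitAddCircle)) 0).symm
    have h3 : ∫⁻ t, ‖f (torusPoint 1 t)‖ₑ ∂(torusMeasure (m + 1))
        = ∫⁻ s : UnitAddCircle, ∫⁻ t, ‖f (Fin.cons (s.toCircle : ℂ) (torusPoint 1 t))‖ₑ
          ∂(torusMeasure m) ∂AddCircle.haarAddCircle := by
      unfold torusMeasure
      rw [← hmp.lintegral_comp_emb (MeasurableEquiv.measurableEmbedding _)]
      have he : ∀ x : UnitAddCircle × (Fin m → UnitAddCircle),
          f (torusPoint 1 ((MeasurableEquiv.piFinSuccAbove (fun _ => UnitAddCircle) 0).symm x))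
            = f (Fin.cons (x.1.toCircle : ℂ) (torusPoint 1 x.2)) := by
        intro x
        congr 1
        funext i
        refine Fin.cases ?_ (fun i => ?_) i
        · simp [torusPoint, MeasurableEquiv.piFinSuccAbove_symm_apply, Fin.insertNthEquiv]
        · simp [torusPoint, MeasurableEquiv.piFinSuccAbove_symm_apply, Fin.insertNthEquiv]
      simp_rw [he]
      rw [lintegral_prod]
      have hc2 : Continuous fun x : UnitAddCircle × (Fin m → UnitAddCircle) =>
          f (Fin.cons (x.1.toCircle : ℂ) (torusPoint 1 x.2)) := by
        have hc3 : Continuous fun x : UnitAddCircle × (Fin m → UnitAddCircle) =>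
            (Fin.cons x.1 x.2 : Fin (m + 1) → UnitAddCircle) := by
          refine continuous_pi fun i => ?_
          refine Fin.cases ?_ (fun i => ?_) i
          · simpa using continuous_fst
          · simp only [Fin.cons_succ]; fun_prop
        refine (hcont.comp hc3).congr fun x => ?_
        simp only [Function.comp_apply]
        congr 1
        funext i
        refine Fin.cases ?_ (fun i => ?_) i <;> simp [torusPoint]
      exact hc2.enorm.measurable.aemeasurable
    rw [h3, Fin.prod_univ_succ, mul_comm (1 - _), ENNReal.ofReal_mul hpos, mul_assoc]
    refine (mul_le_mul_right h2 _).trans ?_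
    rw [← lintegral_const_mul' _ _ ENNReal.ofReal_ne_top]
    exact lintegral_mono fun s => h1 _ (Circle.norm_coe _).le

theorem smul_mem_polydisc {m : ℕ} {r : ℝ} (hr : r ∈ Set.Ioo (0 : ℝ) 1) {z : Fin m → ℂ}
    (hz : ∀ i, ‖z i‖ ≤ 1) : (r : ℂ) • z ∈ polydisc m := by
  intro i
  rw [Pi.smul_apply, norm_smul, Complex.norm_real, Real.norm_of_nonneg hr.1.le]
  nlinarith [hz i, hr.1, hr.2]

theorem torusPoint_mem_polydisc {m : ℕ} {r : ℝ} (hr : r ∈ Set.Ioo (0 : ℝ) 1)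
    (t : Fin m → UnitAddCircle) : torusPoint r t ∈ polydisc m := by
  intro i
  rw [norm_torusPoint hr.1.le]
  exact hr.2

theorem isOpen_polydisc (m : ℕ) : IsOpen (polydisc m) := by
  have : polydisc m = ⋂ i, {z : Fin m → ℂ | ‖z i‖ < 1} := by ext; simp [polydisc]
  rw [this]
  exact isOpen_iInter_of_finite fun i => isOpen_lt (by fun_prop) continuous_const

/-- The torus has total mass one, so L¹ means are dominated by L^p means; the H₁ estimate then
serves every finite p. -/
theorem lintegral_enorm_le_integralNorm {X : Type*} [NormedAddCommGroup X] {p : ℝ≥0∞}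
    (hp : 1 ≤ p) (hp' : p ≠ ∞) {m : ℕ} {f : (Fin m → ℂ) → X} (hf : ContinuousOn f (polydisc m))
    {r : ℝ} (hr : r ∈ Set.Ioo (0 : ℝ) 1) :
    ∫⁻ t, ‖f (torusPoint r t)‖ₑ ∂(torusMeasure m) ≤ integralNorm p m f := by
  have hcont : Continuous fun t : Fin m → UnitAddCircle => f (torusPoint r t) :=
    hf.comp_continuous (continuous_torusPoint r) (torusPoint_mem_polydisc hr)
  have h := eLpNorm_le_eLpNorm_of_exponent_le (μ := torusMeasure m) hp
    (hcont.stronglyMeasurable_of_hasCompactSupport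
      (HasCompactSupport.of_compactSpace _)).aestronglyMeasurable
  rw [eLpNorm_one_eq_lintegral_enorm,
    eLpNorm_eq_lintegral_rpow_enorm_toReal (zero_lt_one.trans_le hp).ne' hp'] at h
  exact h.trans (le_iSup₂ (f := fun (r : ℝ) (_ : r ∈ Set.Ioo (0 : ℝ) 1) =>
    (∫⁻ t, ‖f (torusPoint r t)‖ₑ ^ p.toReal ∂(torusMeasure m)) ^ (1 / p.toReal)) r hr)

/-- The point evaluation estimate in `H_p` of the polydisc. -/
theorem prod_mul_enorm_le_integralNorm {X : Type*} [NormedAddCommGroup X] [NormedSpace ℂ X]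
    [CompleteSpace X] {p : ℝ≥0∞} (hp : 1 ≤ p) (hp' : p ≠ ∞) {m : ℕ} {f : (Fin m → ℂ) → X}
    (hf : DifferentiableOn ℂ f (polydisc m)) {a : Fin m → ℂ} (ha : a ∈ polydisc m) :
    ENNReal.ofReal (∏ i, (1 - ‖a i‖ ^ 2)) * ‖f a‖ₑ ≤ integralNorm p m f := by
  -- The dilation z ↦ f(rz) is holomorphic at every point of the closed polydisc; r → 1 then
  -- recovers f(a).
  have key : ∀ r ∈ Set.Ioo (0 : ℝ) 1,
      ENNReal.ofReal (∏ i, (1 - ‖a i‖ ^ 2)) * ‖f ((r : ℂ) • a)‖ₑ ≤ integralNorm p m f := by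
    intro r hr
    refine (prod_mul_enorm_le_lintegral_torus m (f := fun z => f ((r : ℂ) • z))
      (fun z hz => ?_) ha).trans ?_
    · exact DifferentiableAt.comp z (g := f)
        (hf.differentiableAt ((isOpen_polydisc m).mem_nhds (smul_mem_polydisc hr hz)))
        (by fun_prop)
    · have : ∀ t : Fin m → UnitAddCircle, (r : ℂ) • torusPoint 1 t = torusPoint r t := by
        intro t
        funext i
        simp [torusPoint]
      simp_rw [this]
      exact lintegral_enorm_le_integralNorm hp hp' hf.continuousOn hr
  have hlim : Tendsto (fun r : ℝ => ‖f ((r : ℂ) • a)‖ₑ) (𝓝[<] 1) (𝓝 ‖f a‖ₑ) := by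
    have h1 : Tendsto (fun r : ℝ => (r : ℂ) • a) (𝓝[<] 1) (𝓝 a) := by
      have : Continuous fun r : ℝ => (r : ℂ) • a := by fun_prop
      simpa using (this.tendsto 1).mono_left nhdsWithin_le_nhds
    exact ((hf.differentiableAt ((isOpen_polydisc m).mem_nhds ha)).continuousAt.tendsto.comp
      h1).enorm
  refine le_of_tendsto (ENNReal.Tendsto.const_mul hlim (Or.inr ENNReal.ofReal_ne_top)) ?_
  filter_upwards [Ioo_mem_nhdsLT zero_lt_one] with r hr using key r hr


/-! ### Coherence of functions with common monomial coefficients -/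

open BanachSequenceSpace

theorem integralNorm_congr {X : Type*} [NormedAddCommGroup X] (p : ℝ≥0∞) {m : ℕ}
    {f g : (Fin m → ℂ) → X} (h : Set.EqOn f g (polydisc m)) :
    integralNorm p m f = integralNorm p m g := by
  unfold integralNorm
  refine iSup_congr fun r => iSup_congr fun hr => ?_
  simp_rw [h (torusPoint_mem_polydisc hr _)]

section Coefficients

variable {X : Type*} [NormedAddCommGroup X] [NormedSpace ℂ X] {c : (ℕ →₀ ℕ) → X}

/-- Functions in different numbers of variables with the same monomial coefficients agree where
the additional variables vanish. -/
theorem HasCoeffsPolydisc.eq_comp_castLE {m k : ℕ} (hmk : m ≤ k) {f : (Fin m → ℂ) → X}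
    {g : (Fin k → ℂ) → X} (hf : HasCoeffsPolydisc m f c) (hg : HasCoeffsPolydisc k g c)
    {z : Fin k → ℂ} (hz : z ∈ polydisc k) (hz0 : ∀ i : Fin k, m ≤ (i : ℕ) → z i = 0) :
    g z = f fun i => z (Fin.castLE hmk i) := by
  let ι : Fin m ↪ Fin k := Fin.castLEEmb hmk
  have h1 := hf (fun i => z (Fin.castLE hmk i)) fun i => hz _
  have h2 := hg z hz
  -- Only multi-indices supported in the first m places contribute: any other monomial contains a
  -- vanishing coordinate of z.
  rw [← (Finsupp.embDomain_injective (M := ℕ) ι).hasSum_iff] at h2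
  · refine h2.unique (h1.congr_fun fun α => ?_)
    simp only [Function.comp_apply]
    congr 1
    · have hr : ∀ i : Fin k, i ∉ Set.range (Fin.castLE hmk) →
          z i ^ (Finsupp.embDomain ι α) i = 1 := by
        intro i hi
        rw [Finsupp.embDomain_of_notMem_range _ _ _ hi, pow_zero]
      rw [← Finset.prod_subset (Finset.subset_univ (Finset.univ.map ι)), Finset.prod_map]
      · refine Finset.prod_congr rfl fun i _ => ?_
        rw [Finsupp.embDomain_apply_self]
        rfl
      · intro i _ hi
        refine hr i fun ⟨j, hj⟩ => hi ?_
        exact Finset.mem_map.2 ⟨j, Finset.mem_univ _, hj⟩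
    · simp only [Finsupp.embDomain_eq_mapDomain, ← Finsupp.mapDomain_comp]
      rfl
  · intro α hα
    rw [Finsupp.mem_range_embDomain_iff, Set.not_subset] at hα
    obtain ⟨i, hi, hir⟩ := hα
    have hmi : m ≤ (i : ℕ) := by
      by_contra! hlt
      exact hir ⟨⟨i, hlt⟩, rfl⟩
    rw [Finset.prod_eq_zero (Finset.mem_univ i), zero_smul]
    rw [hz0 i hmi, zero_pow (Finsupp.mem_support_iff.1 hi)]

theorem HasCoeffsPolydisc.eqOn {m : ℕ} {f g : (Fin m → ℂ) → X}
    (hf : HasCoeffsPolydisc m f c) (hg : HasCoeffsPolydisc m g c) : Set.EqOn f g (polydisc m) :=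
  fun z hz => (hf z hz).unique (hg z hz)

end Coefficients

/-! ### Coordinates and finite sections in the sequence space -/

section SequenceSpaceLemmas

variable {S : Type*} [NormedAddCommGroup S] [NormedSpace ℂ S] [CompleteSpace S]
  [BanachSequenceSpace S]

theorem norm_toC0_apply_le (x : S) (n : ℕ) : ‖toC0 x n‖ ≤ ‖toC0 x‖ :=
  (c0_norm_le_iff _ (norm_nonneg _)).1 le_rfl n

/-- The projection onto the first `m` coordinates. -/
noncomputable def coordCLM (hS : ∀ x : S, ‖toC0 x‖ ≤ ‖x‖) (m : ℕ) : S →L[ℂ] (Fin m → ℂ) :=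
  ContinuousLinearMap.pi fun i => LinearMap.mkContinuous
    { toFun := fun x : S => toC0 x (i : ℕ)
      map_add' := fun x y => by simp
      map_smul' := fun a x => by simp } 1
    fun x => by simpa using (norm_toC0_apply_le x i).trans (hS x)

theorem coordCLM_apply (hS : ∀ x : S, ‖toC0 x‖ ≤ ‖x‖) (m : ℕ) (x : S) (i : Fin m) :
    coordCLM hS m x i = toC0 x i := rfl

theorem coordCLM_mem_polydisc (hS : ∀ x : S, ‖toC0 x‖ ≤ ‖x‖) (m : ℕ) {x : S}
    (hx : x ∈ unitDomain S) : coordCLM hS m x ∈ polydisc m :=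
  fun i => (norm_toC0_apply_le x i).trans_lt hx

theorem toC0_finIncl (m : ℕ) (z : Fin m → ℂ) (n : ℕ) :
    toC0 (finIncl S m z) n = if h : n < m then z ⟨n, h⟩ else 0 := by
  have h1 : toC0 (finIncl S m z) n = ∑ i : Fin m, if n = (i : ℕ) then z i else 0 := by
    have : ∀ s : Finset (Fin m), toC0 (∑ i ∈ s, z i • e (S := S) (i : ℕ)) n
        = ∑ i ∈ s, if n = (i : ℕ) then z i else 0 := by
      intro s
      induction s using Finset.induction_on with
      | empty => simp
      | insert i s hi ih =>
        rw [Finset.sum_insert hi, Finset.sum_insert hi, map_add,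
          ZeroAtInftyContinuousMap.add_apply, ih, map_smul,
          ZeroAtInftyContinuousMap.smul_apply, toC0_e]
        simp
    exact this Finset.univ
  rw [h1]
  split_ifs with h
  · rw [Finset.sum_eq_single ⟨n, h⟩]
    · simp
    · intro i _ hi
      rw [if_neg]
      rintro rfl
      exact hi rfl
    · simp
  · refine Finset.sum_eq_zero fun i _ => if_neg ?_
    rintro rfl
    exact h i.2

theorem toC0_finIncl_coord (m : ℕ) (z : Fin m → ℂ) (i : Fin m) :
    toC0 (finIncl S m z) (i : ℕ) = z i := by
  rw [toC0_finIncl, dif_pos i.2]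

theorem norm_toC0_finIncl_le (m : ℕ) (z : Fin m → ℂ) : ‖toC0 (finIncl S m z)‖ ≤ ‖z‖ := by
  refine (c0_norm_le_iff _ (norm_nonneg _)).2 fun n => ?_
  rw [toC0_finIncl]
  split_ifs with h
  · exact norm_le_pi_norm z _
  · simp

theorem finIncl_mem_unitDomain {m : ℕ} {z : Fin m → ℂ} (hz : z ∈ polydisc m) :
    finIncl S m z ∈ unitDomain S :=
  (norm_toC0_finIncl_le m z).trans_lt ((pi_norm_lt_iff one_pos).2 hz)

theorem differentiable_finIncl (m : ℕ) : Differentiable ℂ (finIncl S m) := by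
  unfold finIncl
  fun_prop

theorem tendsto_finIncl_coordCLM (hS : ∀ x : S, ‖toC0 x‖ ≤ ‖x‖) (x : S) :
    Tendsto (fun m => finIncl S m (coordCLM hS m x)) atTop (𝓝 x) := by
  refine (tendsto_sum x).congr fun m => ?_
  exact (Fin.sum_univ_eq_sum_range (fun n => toC0 x n • e (S := S) n) m).symm

theorem isOpen_unitDomain (hS : ∀ x : S, ‖toC0 x‖ ≤ ‖x‖) : IsOpen (unitDomain S) := by
  let T : S →L[ℂ] C₀(ℕ, ℂ) := LinearMap.mkContinuous toC0 1 fun x => by simpa using hS x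
  exact isOpen_lt T.continuous.norm continuous_const

/-! ### Passing between B_{c₀} ∩ S and the polydiscs -/

variable {X : Type*} [NormedAddCommGroup X] [NormedSpace ℂ X] {c : (ℕ →₀ ℕ) → X}

/-- The Hardy norm is the supremum of the Hardy norms of the finite dimensional sections. -/
theorem hardyNorm_eq_iSup (hS : ∀ x : S, ‖toC0 x‖ ≤ ‖x‖) (p : ℝ≥0∞) {F : S → X}
    {f : (m : ℕ+) → (Fin (m : ℕ) → ℂ) → X} (hF : DifferentiableOn ℂ F (unitDomain S))
    (hFc : HasCoeffs F c) (hfc : ∀ m : ℕ+, HasCoeffsPolydisc m (f m) c) :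
    hardyNorm p F = ⨆ m : ℕ+, polydiscNorm p m (f m) := by
  have heq : ∀ m : ℕ+, Set.EqOn (fun z => F (finIncl S m z)) (f m) (polydisc m) :=
    fun m => (hFc m).eqOn (hfc m)
  unfold hardyNorm polydiscNorm
  split_ifs with hp
  · refine le_antisymm (iSup₂_le fun x hx => ?_) (iSup_le fun m => iSup₂_le fun z hz => ?_)
    -- Continuity of F at x bounds ‖F x‖ by the values at finite sections of x.
    · have hlim : Tendsto (fun m => ‖F (finIncl S m (coordCLM hS m x))‖ₑ) atTop (𝓝 ‖F x‖ₑ) :=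
        ((hF.differentiableAt ((isOpen_unitDomain hS).mem_nhds hx)).continuousAt.tendsto.comp
          (tendsto_finIncl_coordCLM hS x)).enorm
      refine le_of_tendsto hlim ?_
      filter_upwards [eventually_gt_atTop 0] with m hm
      have hx' := coordCLM_mem_polydisc hS m hx
      have h1 := heq ⟨m, hm⟩ hx'
      simp only [PNat.mk_coe] at h1
      rw [h1]
      exact le_iSup_of_le (f := fun k : ℕ+ => ⨆ z ∈ polydisc k, ‖f k z‖ₑ) ⟨m, hm⟩
        (le_iSup₂ (f := fun (z : Fin m → ℂ) (_ : z ∈ polydisc m) => ‖f ⟨m, hm⟩ z‖ₑ) _ hx')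
    · rw [← heq m hz]
      exact le_iSup₂ (f := fun (x : S) (_ : x ∈ unitDomain S) => ‖F x‖ₑ) _
        (finIncl_mem_unitDomain hz)
  · exact iSup_congr fun m => integralNorm_congr p (heq m)

theorem MemHardy.exists_polydisc (hS : ∀ x : S, ‖toC0 x‖ ≤ ‖x‖) {p : ℝ≥0∞} {F : S → X}
    (hF : MemHardy p F) (hFc : HasCoeffs F c) :
    ∃ f : (m : ℕ+) → (Fin (m : ℕ) → ℂ) → X,
      (∀ m : ℕ+, MemHardyPolydisc p m (f m)) ∧ (∀ m : ℕ+, HasCoeffsPolydisc m (f m) c) ∧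
        (⨆ m : ℕ+, polydiscNorm p m (f m)) < ∞ := by
  have hlt : (⨆ m : ℕ+, polydiscNorm p m fun z => F (finIncl S m z)) < ∞ := by
    rw [← hardyNorm_eq_iSup hS p hF.1 hFc hFc]
    exact hF.2
  refine ⟨fun m z => F (finIncl S m z), fun m => ⟨?_, ?_⟩, hFc, hlt⟩
  · exact hF.1.comp (differentiable_finIncl _).differentiableOn fun z hz =>
      finIncl_mem_unitDomain hz
  · exact (le_iSup (fun m : ℕ+ => polydiscNorm p m fun z => F (finIncl S m z)) m).trans_lt hlt

/-- A coherent, locally uniformly bounded sequence of holomorphic functions on the polydiscs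
extends to a holomorphic function on `B_{c₀} ∩ S`. -/
theorem exists_differentiableOn_hasCoeffs [CompleteSpace X] (hS : ∀ x : S, ‖toC0 x‖ ≤ ‖x‖)
    {f : (m : ℕ+) → (Fin (m : ℕ) → ℂ) → X}
    (hd : ∀ m : ℕ+, DifferentiableOn ℂ (f m) (polydisc m))
    (hfc : ∀ m : ℕ+, HasCoeffsPolydisc m (f m) c)
    (hb : ∀ a ∈ unitDomain S, ∃ R > 0, ∃ C : ℝ, ∀ z ∈ Metric.ball a R, z ∈ unitDomain S →
      ∀ m : ℕ+, ‖f m (coordCLM hS m z)‖ ≤ C) :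
    ∃ F : S → X, DifferentiableOn ℂ F (unitDomain S) ∧ HasCoeffs F c := by
  have hopen := isOpen_unitDomain hS
  -- The shift avoids m = 0: `G n` depends on the first n + 1 coordinates.
  let G : ℕ → S → X := fun n x => f n.succPNat (coordCLM hS (n + 1) x)
  have hGd : ∀ n, DifferentiableOn ℂ (G n) (unitDomain S) := fun n =>
    (hd n.succPNat).comp (coordCLM hS (n + 1)).differentiable.differentiableOn
      fun x hx => coordCLM_mem_polydisc hS _ hx
  have hGb : ∀ a ∈ unitDomain S, ∃ R > 0, ∃ C : ℝ, Metric.ball a R ⊆ unitDomain S ∧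
      ∀ n, ∀ z ∈ Metric.ball a R, ‖G n z‖ ≤ C := by
    intro a ha
    obtain ⟨R, hR, C, hC⟩ := hb a ha
    obtain ⟨R', hR', hsub⟩ := Metric.isOpen_iff.1 hopen a ha
    refine ⟨min R R', lt_min hR hR', C,
      (Metric.ball_subset_ball (min_le_right _ _)).trans hsub, fun n z hz => ?_⟩
    exact hC z (Metric.ball_subset_ball (min_le_left _ _) hz)
      (hsub (Metric.ball_subset_ball (min_le_right _ _) hz)) n.succPNat
  have hGf : ∀ (m : ℕ+) (n : ℕ), (m : ℕ) ≤ n + 1 → ∀ z ∈ polydisc m,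
      G n (finIncl S m z) = f m z := by
    intro m n hmn z hz
    refine ((hfc m).eq_comp_castLE hmn (hfc n.succPNat)
      (coordCLM_mem_polydisc hS _ (finIncl_mem_unitDomain hz)) fun i hi => ?_).trans ?_
    · rw [coordCLM_apply, toC0_finIncl, dif_neg (not_lt.2 hi)]
    · congr 1
      funext i
      exact toC0_finIncl_coord _ z i
  -- Let y be the section of x of length N + 1. Coherence gives `G n y = G N x` for all n ≥ N, so `G
  -- n x - G N x` is controlled by ‖y - x‖ through a Lipschitz constant independent of n.
  have hcau : ∀ x ∈ unitDomain S, CauchySeq fun n => G n x := by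
    intro x hx
    obtain ⟨R, hR, C, hsub, hC⟩ := hGb x hx
    have hC0 : 0 ≤ C := (norm_nonneg _).trans (hC 0 x (Metric.mem_ball_self hR))
    rw [Metric.cauchySeq_iff']
    intro ε hε
    have hlim := (tendsto_finIncl_coordCLM hS x).comp (tendsto_add_atTop_nat 1)
    -- 2C/R is the common Lipschitz constant; adding 1 keeps the denominator positive when C = 0.
    obtain ⟨N, hN⟩ := (Metric.tendsto_atTop.1 hlim) (min R (ε / (2 * C / R + 1))) (by positivity)
    refine ⟨N, fun n hn => ?_⟩
    have hx' := hN N le_rfl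
    simp only [Function.comp_apply] at hx'
    set y := finIncl S (N + 1) (coordCLM hS (N + 1) x) with hy
    have hyR : y ∈ Metric.ball x R := hx'.trans_le (min_le_left _ _)
    have hyG : G n y = G N x :=
      hGf N.succPNat n (by simpa using hn) _ (coordCLM_mem_polydisc hS _ hx)
    rw [dist_comm, ← hyG, dist_eq_norm]
    have hyε : ‖y - x‖ < ε / (2 * C / R + 1) := by
      rw [← dist_eq_norm]
      exact hx'.trans_le (min_le_right _ _)
    calc ‖G n y - G n x‖ ≤ 2 * C / R * ‖y - x‖ :=
          norm_sub_le_of_differentiableOn_ball ((hGd n).mono hsub) (hC n) hyR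
      _ ≤ (2 * C / R + 1) * ‖y - x‖ := by gcongr; linarith
      _ < (2 * C / R + 1) * (ε / (2 * C / R + 1)) := by gcongr
      _ = ε := by field_simp
  -- Outside the domain the limit function takes the default value 0.
  have hex : ∀ x : S, ∃ L : X, x ∈ unitDomain S → Tendsto (fun n => G n x) atTop (𝓝 L) := by
    intro x
    by_cases hx : x ∈ unitDomain S
    · obtain ⟨L, hL⟩ := cauchySeq_tendsto_of_complete (hcau x hx)
      exact ⟨L, fun _ => hL⟩
    · exact ⟨0, fun h => absurd h hx⟩
  choose F hF using hex
  refine ⟨F, fun a ha => ?_, fun m z hz => ?_⟩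
  · obtain ⟨R, hR, C, hsub, hC⟩ := hGb a ha
    exact (differentiableAt_of_tendsto_of_bounded hR (fun n => (hGd n).mono hsub) hC
      fun z hz => hF z (hsub hz)).differentiableWithinAt
  · have h1 : F (finIncl S m z) = f m z := by
      refine tendsto_nhds_unique (hF _ (finIncl_mem_unitDomain hz))
        (tendsto_const_nhds.congr' ?_)
      filter_upwards [eventually_ge_atTop (m : ℕ)] with n hn
      exact (hGf m n (hn.trans n.le_succ) z hz).symm
    simp only [h1]
    exact hfc m z hz

end SequenceSpaceLemmas

/-! ### Local uniform bounds over c₀ and ℓ₂ -/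

/-- The class `BanachSequenceSpace` does not normalise the vectors `e n`, so contractivity of the
inclusion in c₀, the hypothesis `hS` above, is checked for each space. -/
theorem norm_toC0_le_c0 (x : C₀(ℕ, ℂ)) : ‖toC0 x‖ ≤ ‖x‖ := le_rfl

theorem norm_toC0_le_l2 (x : L2Seq) : ‖toC0 x‖ ≤ ‖x‖ :=
  (c0_norm_le_iff _ (norm_nonneg _)).2 fun n => lp.norm_apply_le_norm two_ne_zero x n

/-- Each factor satisfies 1/(1 - x) = 1 + x/(1 - x) ≤ exp(x/(1 - q)). The resulting bound does not
depend on the number of factors, hence is uniform in m when x_i = |z_i|² with z in a bounded part of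
ℓ₂. -/
theorem exp_neg_le_prod_one_sub {ι : Type*} [Fintype ι] {x : ι → ℝ} {q B : ℝ} (hq : q < 1)
    (hx0 : ∀ i, 0 ≤ x i) (hxq : ∀ i, x i ≤ q) (hB : ∑ i, x i ≤ B) :
    Real.exp (-(B / (1 - q))) ≤ ∏ i, (1 - x i) := by
  have hq' : 0 < 1 - q := by linarith
  have h1 : ∀ i, Real.exp (-(x i / (1 - q))) ≤ 1 - x i := by
    intro i
    have hxi : 0 < 1 - x i := by linarith [hxq i]
    rw [Real.exp_neg, inv_le_comm₀ (Real.exp_pos _) hxi]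
    calc (1 - x i)⁻¹ = x i / (1 - x i) + 1 := by field_simp; ring
      _ ≤ x i / (1 - q) + 1 := by
        gcongr
        · exact hx0 i
        · exact hxq i
      _ ≤ _ := Real.add_one_le_exp _
  calc Real.exp (-(B / (1 - q))) ≤ Real.exp (∑ i, -(x i / (1 - q))) := by
        rw [Finset.sum_neg_distrib, ← Finset.sum_div]
        gcongr
    _ = ∏ i, Real.exp (-(x i / (1 - q))) := Real.exp_sum _ _
    _ ≤ _ := Finset.prod_le_prod (fun i _ => (Real.exp_pos _).le) fun i _ => h1 i

theorem sum_norm_sq_coord_le (x : L2Seq) (m : ℕ) :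
    ∑ i : Fin m, ‖coordCLM norm_toC0_le_l2 m x i‖ ^ 2 ≤ ‖x‖ ^ 2 := by
  have h := lp.sum_rpow_le_norm_rpow (p := 2) (by norm_num) x (Finset.range m)
  rw [← Fin.sum_univ_eq_sum_range (fun n => ‖x n‖ ^ (2 : ℝ≥0∞).toReal) m] at h
  simpa using! h

theorem norm_le_toReal_of_enorm_le {X : Type*} [NormedAddCommGroup X] {x : X} {M : ℝ≥0∞} (hM : M ≠ ∞) (h : ‖x‖ₑ ≤ M) :
    ‖x‖ ≤ M.toReal := by
  rw [← toReal_enorm]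
  exact ENNReal.toReal_mono hM h

variable {X : Type*} [NormedAddCommGroup X] [NormedSpace ℂ X] {c : (ℕ →₀ ℕ) → X}

theorem exists_memHardy_c0 [CompleteSpace X] {f : (m : ℕ+) → (Fin (m : ℕ) → ℂ) → X}
    (hf : ∀ m : ℕ+, MemHardyPolydisc ∞ m (f m)) (hfc : ∀ m : ℕ+, HasCoeffsPolydisc m (f m) c)
    (hM : (⨆ m : ℕ+, polydiscNorm ∞ m (f m)) < ∞) :
    ∃ F : C₀(ℕ, ℂ) → X, MemHardy ∞ F ∧ HasCoeffs F c := by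
  obtain ⟨F, hF, hFc⟩ := exists_differentiableOn_hasCoeffs norm_toC0_le_c0 (fun m => (hf m).1) hfc
    -- The supremum bound holds on the whole domain, so any radius would do.
    fun a _ => ⟨1, one_pos, (⨆ m : ℕ+, polydiscNorm ∞ m (f m)).toReal, fun z _ hz m =>
      norm_le_toReal_of_enorm_le hM.ne <|
        le_trans (by
          rw [polydiscNorm, if_pos rfl]
          exact le_iSup₂ (f := fun (w : Fin (m : ℕ) → ℂ) (_ : w ∈ polydisc m) => ‖f m w‖ₑ) _
            (coordCLM_mem_polydisc _ _ hz))
        (le_iSup (fun m : ℕ+ => polydiscNorm ∞ m (f m)) m)⟩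
  refine ⟨F, ⟨hF, ?_⟩, hFc⟩
  rwa [hardyNorm_eq_iSup norm_toC0_le_c0 _ hF hFc hfc]

theorem exists_memHardy_l2 [CompleteSpace X] {p : ℝ≥0∞} (hp : 1 ≤ p) (hp' : p ≠ ∞)
    {f : (m : ℕ+) → (Fin (m : ℕ) → ℂ) → X}
    (hf : ∀ m : ℕ+, MemHardyPolydisc p m (f m)) (hfc : ∀ m : ℕ+, HasCoeffsPolydisc m (f m) c)
    (hM : (⨆ m : ℕ+, polydiscNorm p m (f m)) < ∞) :
    ∃ F : L2Seq → X, MemHardy p F ∧ HasCoeffs F c := by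
  set M := ⨆ m : ℕ+, polydiscNorm p m (f m) with hMdef
  obtain ⟨F, hF, hFc⟩ := exists_differentiableOn_hasCoeffs norm_toC0_le_l2 (fun m => (hf m).1) hfc
    (by
      intro a ha
      have hs : ‖toC0 a‖ < 1 := ha
      set s := ‖toC0 a‖ with hsdef
      -- On the ball of radius (1 - s)/2 about `a`, the sup norm stays below q = (1 + s)/2 < 1 and
      -- the ℓ₂ norm below ‖a‖ + (1 - s)/2; δ is the resulting lower bound for ∏(1 - |z_i|²).
      set q := (s + (1 - s) / 2) with hq
      have hq1 : q < 1 := by linarith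
      have hq0 : 0 ≤ q := by linarith [norm_nonneg (toC0 a)]
      have hqq : q ^ 2 < 1 := by nlinarith
      set δ := Real.exp (-((‖a‖ + (1 - s) / 2) ^ 2 / (1 - q ^ 2))) with hδ
      have hδ0 : 0 < δ := Real.exp_pos _
      refine ⟨(1 - s) / 2, by linarith, M.toReal / δ, fun z hz hzd m => ?_⟩
      rw [Metric.mem_ball, dist_eq_norm] at hz
      have hzq : ‖toC0 z‖ ≤ q := by
        have h1 : toC0 z = toC0 a + toC0 (z - a) := by rw [← map_add, add_sub_cancel]
        rw [h1]
        linarith [norm_add_le (toC0 a) (toC0 (z - a)), norm_toC0_le_l2 (z - a)]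
      have hzB : ‖z‖ ≤ ‖a‖ + (1 - s) / 2 := by
        have h1 : z = a + (z - a) := by rw [add_sub_cancel]
        rw [h1]
        linarith [norm_add_le a (z - a)]
      set w := coordCLM norm_toC0_le_l2 m z with hw
      have hprod : δ ≤ ∏ i, (1 - ‖w i‖ ^ 2) :=
        exp_neg_le_prod_one_sub hqq (fun i => by positivity)
          (fun i => pow_le_pow_left₀ (norm_nonneg _) ((norm_toC0_apply_le z i).trans hzq) 2)
          ((sum_norm_sq_coord_le z m).trans (pow_le_pow_left₀ (norm_nonneg _) hzB 2))
      have hle := prod_mul_enorm_le_integralNorm hp hp' (hf m).1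
        (coordCLM_mem_polydisc norm_toC0_le_l2 m hzd)
      have hint : integralNorm p m (f m) ≤ M := by
        have := le_iSup (fun m : ℕ+ => polydiscNorm p m (f m)) m
        simpa only [polydiscNorm, if_neg hp', hMdef] using this
      have h2 : ENNReal.ofReal δ * ‖f m w‖ₑ ≤ M :=
        (mul_le_mul_left (ENNReal.ofReal_le_ofReal hprod) _).trans (hle.trans hint)
      have h3 := ENNReal.toReal_mono hM.ne h2
      rw [ENNReal.toReal_mul, ENNReal.toReal_ofReal hδ0.le, toReal_enorm] at h3
      rw [le_div_iff₀ hδ0, mul_comm]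
      exact h3)
  refine ⟨F, ⟨hF, ?_⟩, hFc⟩
  rwa [hardyNorm_eq_iSup norm_toC0_le_l2 _ hF hFc hfc]

end HardyHilbert

theorem mainTheorem12 {X : Type*} [NormedAddCommGroup X] [NormedSpace ℂ X] [CompleteSpace X]
    (p : ℝ≥0∞) (hp : 1 ≤ p) (c : (ℕ →₀ ℕ) → X) :
    (p = ∞ →
      ((∃ F : C₀(ℕ, ℂ) → X, MemHardy p F ∧ HasCoeffs F c) ↔
        (∃ f : (m : ℕ+) → (Fin (m : ℕ) → ℂ) → X,
          (∀ m : ℕ+, MemHardyPolydisc p m (f m)) ∧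
          (∀ m : ℕ+, HasCoeffsPolydisc m (f m) c) ∧
          (⨆ m : ℕ+, polydiscNorm p m (f m)) < ∞)) ∧
      (∀ (F : C₀(ℕ, ℂ) → X) (f : (m : ℕ+) → (Fin (m : ℕ) → ℂ) → X),
        MemHardy p F → HasCoeffs F c →
        (∀ m : ℕ+, MemHardyPolydisc p m (f m)) →
        (∀ m : ℕ+, HasCoeffsPolydisc m (f m) c) →
        (⨆ m : ℕ+, polydiscNorm p m (f m)) < ∞ →
        hardyNorm p F = ⨆ m : ℕ+, polydiscNorm p m (f m))) ∧
    (p ≠ ∞ →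
      ((∃ F : L2Seq → X, MemHardy p F ∧ HasCoeffs F c) ↔
        (∃ f : (m : ℕ+) → (Fin (m : ℕ) → ℂ) → X,
          (∀ m : ℕ+, MemHardyPolydisc p m (f m)) ∧
          (∀ m : ℕ+, HasCoeffsPolydisc m (f m) c) ∧
          (⨆ m : ℕ+, polydiscNorm p m (f m)) < ∞)) ∧
      (∀ (F : L2Seq → X) (f : (m : ℕ+) → (Fin (m : ℕ) → ℂ) → X),
        MemHardy p F → HasCoeffs F c →
        (∀ m : ℕ+, MemHardyPolydisc p m (f m)) →
        (∀ m : ℕ+, HasCoeffsPolydisc m (f m) c) →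
        (⨆ m : ℕ+, polydiscNorm p m (f m)) < ∞ →
        hardyNorm p F = ⨆ m : ℕ+, polydiscNorm p m (f m))) := by
  refine ⟨?_, fun hp' => ⟨⟨?_, ?_⟩, ?_⟩⟩
  · rintro rfl
    refine ⟨⟨?_, ?_⟩, ?_⟩
    · rintro ⟨F, hF, hFc⟩
      exact hF.exists_polydisc norm_toC0_le_c0 hFc
    · rintro ⟨f, hf, hfc, hM⟩
      exact exists_memHardy_c0 hf hfc hM
    · intro F f hF hFc _ hfc _
      exact hardyNorm_eq_iSup norm_toC0_le_c0 _ hF.1 hFc hfc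
  · rintro ⟨F, hF, hFc⟩
    exact hF.exists_polydisc norm_toC0_le_l2 hFc
  · rintro ⟨f, hf, hfc, hM⟩
    exact exists_memHardy_l2 hp hp' hf hfc hM
  · intro F f hF hFc _ hfc _
    exact hardyNorm_eq_iSup norm_toC0_le_l2 _ hF.1 hFc hfc
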